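/- Let $K$ be a field that is complete with respect to an absolute value $|\cdot|$ (for example $K=\mathbb{C}$), and let $q\in K$ with $|q|<1$. Write $(a;q)_n=\prod_{j=0}^{n-1}(1-aq^j)$ for $n\ge 0$ and $(a;q)_\infty=\prod_{j\ge 0}(1-aq^j)$. Then the infinite products and series below converge, $(q;q)_n\neq 0$ for all $n \ge 0$, $(q;q)_\infty\ne 0$, and $$\sum_{n\ge 0}\frac{q^{2n^2+n}}{(q;q)_{2n+1}}=\frac{1}{(q;q)_\infty}\sum_{k\in\mathbb{Z}}(-1)^kq^{3k^2-k}=\frac{(q^2;q^2)_\infty}{(q;q)_\infty}=(-q;q)_\infty$$ and $$\sum_{n\ge 0}\frac{q^{2n^2-n}}{(q;q)_{2n}}=\frac{1}{(q;q)_\infty}\sum_{k\in\mathbb{Z}}(-1)^kq^{3k^2-k}=\frac{(q^2;q^2)_\infty}{(q;q)_\infty}=(-q;q)_\infty .$$ -/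

import Mathlib

/-- The finite `q`-shifted factorial `(a; q)_n = ∏_{j=0}^{n-1} (1 - a q^j)`. -/
def qPoch {K : Type*} [CommRing K] (a q : K) (n : ℕ) : K :=
  ∏ j ∈ Finset.range n, (1 - a * q ^ j)

/-- The infinite `q`-shifted factorial `(a; q)_∞ = ∏_{j ≥ 0} (1 - a q^j)`. -/
noncomputable def qPochInf {K : Type*} [CommRing K] [TopologicalSpace K] (a q : K) : K :=
  ∏' j : ℕ, (1 - a * q ^ j)

/-! Euler's identity (`hasSum_eulerTerm`) at `z = q` expands `(-q; q)_∞` as `∑ q^(n(n+1)/2) / (q;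
q)_n`. Adding its terms in pairs `2n, 2n + 1` gives the first series; keeping the term `1` of index
`0` and pairing `2n + 1, 2n + 2` gives the second. The factorization `1 - q^(2j+2) = (1 + q^(j+1))
(1 - q^(j+1))` gives the product forms, and the bilateral sum is the pentagonal number theorem at `x
= q^2`. -/

open Filter Topology

/-! ### Euler's identity and the pairing of its terms -/

section QSeries

variable {K : Type*} [NormedField K]

theorem summable_norm_mul_geometric {q : K} (hq : ‖q‖ < 1) (a : K) :
    Summable fun j : ℕ => ‖a * q ^ j‖ := by
  simpa [norm_mul, norm_pow] using
    (summable_geometric_of_lt_one (norm_nonneg q) hq).mul_left ‖a‖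

theorem multipliable_one_sub_mul_pow [CompleteSpace K] {q : K} (hq : ‖q‖ < 1) (a : K) :
    Multipliable fun j : ℕ => 1 - a * q ^ j := by
  simpa [sub_eq_add_neg] using
    multipliable_one_add_of_summable (f := fun j : ℕ => -(a * q ^ j))
      (by simpa using summable_norm_mul_geometric hq a)

theorem one_sub_mul_pow_ne_zero {q : K} (hq : ‖q‖ < 1) (j : ℕ) : 1 - q * q ^ j ≠ 0 := by
  intro h
  have h1 : ‖q ^ (j + 1)‖ = 1 := by
    rw [pow_succ', ← sub_eq_zero.mp h, norm_one]
  rw [norm_pow] at h1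
  exact (pow_lt_one₀ (norm_nonneg q) hq j.succ_ne_zero).ne h1

theorem qPoch_self_ne_zero {q : K} (hq : ‖q‖ < 1) (n : ℕ) : qPoch q q n ≠ 0 :=
  Finset.prod_ne_zero_iff.mpr fun j _ => one_sub_mul_pow_ne_zero hq j

theorem qPochInf_self_ne_zero [CompleteSpace K] {q : K} (hq : ‖q‖ < 1) :
    qPochInf q q ≠ 0 := by
  have := tprod_one_add_ne_zero_of_summable (f := fun j : ℕ => -(q * q ^ j))
    (by simpa [← sub_eq_add_neg] using one_sub_mul_pow_ne_zero hq)
    (by simpa using summable_norm_mul_geometric hq q)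
  simpa [qPochInf, sub_eq_add_neg] using this

theorem qPoch_succ {R : Type*} [CommRing R] (a q : R) (n : ℕ) :
    qPoch a q (n + 1) = qPoch a q n * (1 - a * q ^ n) :=
  Finset.prod_range_succ _ _

theorem tendsto_qPoch_qPochInf [CompleteSpace K] {q : K} (hq : ‖q‖ < 1) (a : K) :
    Tendsto (qPoch a q) atTop (𝓝 (qPochInf a q)) :=
  (multipliable_one_sub_mul_pow hq a).tendsto_prod_tprod_nat

theorem exists_norm_inv_qPoch_le [CompleteSpace K] {q : K} (hq : ‖q‖ < 1) :
    ∃ C : ℝ, ∀ n, ‖(qPoch q q n)⁻¹‖ ≤ C := by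
  obtain ⟨C, hC⟩ := (((tendsto_qPoch_qPochInf hq q).inv₀
    (qPochInf_self_ne_zero hq)).norm).bddAbove_range
  exact ⟨C, fun n => hC ⟨n, rfl⟩⟩

/-- The general term of Euler's series for `(-z; q)_∞`. -/
noncomputable def eulerTerm (q z : K) (n : ℕ) : K :=
  q ^ (n.choose 2) * z ^ n * (qPoch q q n)⁻¹

theorem norm_eulerTerm_le {q z : K} {C r : ℝ} (hq : ‖q‖ < 1) (hz : ‖z‖ ≤ r)
    (hC : ∀ n, ‖(qPoch q q n)⁻¹‖ ≤ C) (n : ℕ) : ‖eulerTerm q z n‖ ≤ r ^ n * C := by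
  have hr : 0 ≤ r := (norm_nonneg z).trans hz
  rw [eulerTerm, norm_mul, norm_mul, norm_pow, norm_pow]
  gcongr
  · calc ‖q‖ ^ n.choose 2 * ‖z‖ ^ n ≤ 1 * r ^ n := by
          gcongr
          exact pow_le_one₀ (norm_nonneg q) hq.le
      _ = r ^ n := one_mul _
  · exact hC n

theorem summable_eulerTerm [CompleteSpace K] {q z : K} (hq : ‖q‖ < 1) (hz : ‖z‖ < 1) :
    Summable (eulerTerm q z) := by
  obtain ⟨C, hC⟩ := exists_norm_inv_qPoch_le hq
  exact .of_norm_bounded ((summable_geometric_of_lt_one (norm_nonneg z) hz).mul_right C)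
    (norm_eulerTerm_le hq le_rfl hC)

/-- The difference produces the factor `1 - q^(n+1)`, which cancels the last factor of `(q;
q)_(n+1)`. -/
theorem eulerTerm_succ_sub {q : K} (hq : ‖q‖ < 1) (z : K) (n : ℕ) :
    eulerTerm q z (n + 1) - eulerTerm q (z * q) (n + 1) = z * eulerTerm q (z * q) n := by
  have h1 := qPoch_self_ne_zero hq n
  have h2 := one_sub_mul_pow_ne_zero hq n
  simp only [eulerTerm, qPoch_succ, Nat.choose_succ_succ' n 1, Nat.choose_one_right]
  field_simp
  ring

theorem tsum_eulerTerm_eq [CompleteSpace K] {q z : K} (hq : ‖q‖ < 1) (hz : ‖z‖ < 1) :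
    ∑' n, eulerTerm q z n = (1 + z) * ∑' n, eulerTerm q (z * q) n := by
  have hzq : ‖z * q‖ < 1 := by
    rw [norm_mul]
    exact mul_lt_one_of_nonneg_of_lt_one_left (norm_nonneg z) hz hq.le
  have hs := summable_eulerTerm hq hz
  have hs' := summable_eulerTerm hq hzq
  have h : ∑' n, eulerTerm q z n - ∑' n, eulerTerm q (z * q) n
      = z * ∑' n, eulerTerm q (z * q) n := by
    rw [← hs.tsum_sub hs', (hs.sub hs').tsum_eq_zero_add, ← hs'.tsum_mul_left]
    simp only [eulerTerm_succ_sub hq]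
    simp [eulerTerm]
  linear_combination h

theorem tsum_eulerTerm_eq_prod [CompleteSpace K] {q z : K} (hq : ‖q‖ < 1) (hz : ‖z‖ < 1)
    (N : ℕ) : ∑' n, eulerTerm q z n = qPoch (-z) q N * ∑' n, eulerTerm q (z * q ^ N) n := by
  induction N with
  | zero => simp [qPoch]
  | succ N ih =>
    have hN : ‖z * q ^ N‖ < 1 := by
      rw [norm_mul, norm_pow]
      exact mul_lt_one_of_nonneg_of_lt_one_left (norm_nonneg z) hz
        (pow_le_one₀ (norm_nonneg q) hq.le)
    rw [ih, tsum_eulerTerm_eq hq hN, qPoch_succ, pow_succ]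
    ring_nf

/-- **Euler's identity** `∑ q^(n(n-1)/2) z^n / (q; q)_n = (-z; q)_∞`. -/
theorem hasSum_eulerTerm [CompleteSpace K] {q z : K} (hq : ‖q‖ < 1) (hz : ‖z‖ < 1) :
    HasSum (eulerTerm q z) (qPochInf (-z) q) := by
  obtain ⟨C, hC⟩ := exists_norm_inv_qPoch_le hq
  -- Let `N → ∞` in `tsum_eulerTerm_eq_prod`; the majorant `‖z‖^n * C` does not depend on `N`.
  have hlim : Tendsto (fun N : ℕ => ∑' n, eulerTerm q (z * q ^ N) n) atTop
      (𝓝 (∑' n, eulerTerm q 0 n)) := by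
    refine tendsto_tsum_of_dominated_convergence
      ((summable_geometric_of_lt_one (norm_nonneg z) hz).mul_right C) (fun n => ?_)
      (.of_forall fun N n => norm_eulerTerm_le hq ?_ hC n)
    · have h0 : Tendsto (fun N : ℕ => z * q ^ N) atTop (𝓝 0) := by
        simpa using (tendsto_pow_atTop_nhds_zero_of_norm_lt_one hq).const_mul z
      exact ((h0.pow n).const_mul _).mul_const _
    · rw [norm_mul, norm_pow]
      exact mul_le_of_le_one_right (norm_nonneg z) (pow_le_one₀ (norm_nonneg q) hq.le)
  have h0 : ∑' n, eulerTerm q (0 : K) n = 1 := by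
    rw [tsum_eq_single 0 fun n hn => by simp [eulerTerm, hn]]
    simp [eulerTerm, qPoch]
  have h := (tendsto_qPoch_qPochInf hq (-z)).mul hlim
  simp only [← tsum_eulerTerm_eq_prod hq hz, h0, mul_one] at h
  rw [← tendsto_nhds_unique tendsto_const_nhds h]
  exact (summable_eulerTerm hq hz).hasSum

theorem choose_two_two_mul_add (n : ℕ) : (2 * n).choose 2 + 2 * n = 2 * n ^ 2 + n := by
  rw [Nat.choose_two_right]
  rcases n with _ | n
  · rfl
  · rw [show 2 * (n + 1) * (2 * (n + 1) - 1) = 2 * ((n + 1) * (2 * n + 1)) by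
      rw [show 2 * (n + 1) - 1 = 2 * n + 1 by omega]; ring, Nat.mul_div_cancel_left _ two_pos]
    ring

theorem choose_two_two_mul_add_one (n : ℕ) : (2 * n + 1).choose 2 = 2 * n ^ 2 + n := by
  rw [← choose_two_two_mul_add, Nat.choose_succ_succ' (2 * n) 1, Nat.choose_one_right, add_comm]

/-- The terms of Euler's series at `z = q` with indices `2n` and `2n + 1`, added together. -/
theorem eulerTerm_two_mul_add {q : K} (hq : ‖q‖ < 1) (n : ℕ) :
    eulerTerm q q (2 * n) + eulerTerm q q (2 * n + 1)
      = q ^ (2 * (n : ℤ) ^ 2 + n) / qPoch q q (2 * n + 1) := by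
  have h1 := qPoch_self_ne_zero hq (2 * n)
  have h2 := one_sub_mul_pow_ne_zero hq (2 * n)
  have he : q ^ (2 * (n : ℤ) ^ 2 + n) = q ^ (2 * n ^ 2 + n) := by
    rw [← zpow_natCast]; push_cast; rfl
  rw [he, eulerTerm, eulerTerm, ← pow_add, choose_two_two_mul_add, choose_two_two_mul_add_one,
    qPoch_succ]
  field_simp
  ring

/-- The terms of Euler's series at `z = q` with indices `2n + 1` and `2n + 2`, added together. -/
theorem eulerTerm_two_mul_add_one_add {q : K} (hq : ‖q‖ < 1) (n : ℕ) :
    eulerTerm q q (2 * n + 1) + eulerTerm q q (2 * n + 2)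
      = q ^ (2 * ((n + 1 : ℕ) : ℤ) ^ 2 - (n + 1 : ℕ)) / qPoch q q (2 * (n + 1)) := by
  have h2 := one_sub_mul_pow_ne_zero hq (2 * n + 1)
  have he : q ^ (2 * ((n + 1 : ℕ) : ℤ) ^ 2 - (n + 1 : ℕ)) = q ^ (2 * n ^ 2 + n + (2 * n + 1)) := by
    rw [← zpow_natCast]; push_cast; ring_nf
  rw [he, eulerTerm, eulerTerm, ← pow_add _ _ (2 * n + 2), show 2 * n + 2 = 2 * (n + 1) by ring,
    choose_two_two_mul_add, choose_two_two_mul_add_one,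
    show 2 * (n + 1) = 2 * n + 1 + 1 by ring, qPoch_succ _ _ (2 * n + 1), div_eq_mul_inv, mul_inv]
  linear_combination
    (-(q ^ (2 * n ^ 2 + n + (2 * n + 1)) * (qPoch q q (2 * n + 1))⁻¹)) * mul_inv_cancel₀ h2

theorem HasSum.add_two_mul_add_one {f : ℕ → K} {s : K} [CompleteSpace K] (h : HasSum f s) :
    HasSum (fun n => f (2 * n) + f (2 * n + 1)) s := by
  have he : Summable fun n => f (2 * n) :=
    h.summable.comp_injective (mul_right_injective₀ (two_ne_zero' ℕ))
  have ho : Summable fun n => f (2 * n + 1) :=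
    h.summable.comp_injective
      ((add_left_injective 1).comp (mul_right_injective₀ (two_ne_zero' ℕ)))
  rw [h.unique (he.hasSum.even_add_odd ho.hasSum)]
  exact he.hasSum.add ho.hasSum

theorem hasSum_pow_div_qPoch_odd [CompleteSpace K] {q : K} (hq : ‖q‖ < 1) :
    HasSum (fun n : ℕ => q ^ (2 * (n : ℤ) ^ 2 + n) / qPoch q q (2 * n + 1))
      (qPochInf (-q) q) := by
  simpa only [eulerTerm_two_mul_add hq] using (hasSum_eulerTerm hq hq).add_two_mul_add_one

theorem hasSum_pow_div_qPoch_even [CompleteSpace K] {q : K} (hq : ‖q‖ < 1) :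
    HasSum (fun n : ℕ => q ^ (2 * (n : ℤ) ^ 2 - n) / qPoch q q (2 * n)) (qPochInf (-q) q) := by
  have h := hasSum_eulerTerm hq hq
  -- Dropping index `0` shifts the pairing to `2n + 1, 2n + 2`.
  rw [← hasSum_nat_add_iff' 1] at h
  replace h := h.add_two_mul_add_one
  have hf : (fun n => eulerTerm q q (2 * n + 1) + eulerTerm q q (2 * n + 1 + 1)) = fun n : ℕ =>
      q ^ (2 * ((n + 1 : ℕ) : ℤ) ^ 2 - (n + 1 : ℕ)) / qPoch q q (2 * (n + 1)) :=
    funext fun n => eulerTerm_two_mul_add_one_add hq n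
  rw [hf] at h
  rw [← hasSum_nat_add_iff' 1]
  simpa [eulerTerm, qPoch] using h

theorem qPochInf_sq_sq [CompleteSpace K] {q : K} (hq : ‖q‖ < 1) :
    qPochInf (q ^ 2) (q ^ 2) = qPochInf (-q) q * qPochInf q q := by
  rw [qPochInf, qPochInf, qPochInf, ← (multipliable_one_sub_mul_pow hq (-q)).tprod_mul
    (multipliable_one_sub_mul_pow hq q)]
  exact tprod_congr fun j => by ring

end QSeries

/-! ### The pentagonal number theorem in a normed field -/

section Pentagonal

variable {K : Type*} [NormedField K]

/-- By `1 + t ≤ exp t` and the geometric series, the bound is uniform in `k` and `n`. -/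
theorem norm_prod_one_sub_pow_le {x : K} (hx : ‖x‖ < 1) (k n : ℕ) :
    ‖∏ i ∈ Finset.range n, (1 - x ^ (k + i + 1))‖ ≤ Real.exp (1 - ‖x‖)⁻¹ := by
  calc ‖∏ i ∈ Finset.range n, (1 - x ^ (k + i + 1))‖
      ≤ ∏ i ∈ Finset.range n, Real.exp (‖x‖ ^ i) := by
        rw [norm_prod]
        refine Finset.prod_le_prod (fun _ _ => norm_nonneg _) fun i _ => ?_
        calc ‖1 - x ^ (k + i + 1)‖ ≤ 1 + ‖x‖ ^ (k + i + 1) := by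
              simpa using norm_sub_le (1 : K) (x ^ (k + i + 1))
          _ ≤ ‖x‖ ^ i + 1 := by
              rw [add_comm, add_le_add_iff_right]
              exact pow_le_pow_of_le_one (norm_nonneg x) hx.le (by omega)
          _ ≤ _ := Real.add_one_le_exp _
    _ ≤ Real.exp (1 - ‖x‖)⁻¹ := by
        rw [← Real.exp_sum, Real.exp_le_exp, ← tsum_geometric_of_lt_one (norm_nonneg x) hx]
        exact (summable_geometric_of_lt_one (norm_nonneg x) hx).sum_le_tsum _
          fun i _ => pow_nonneg (norm_nonneg x) i

theorem norm_pow_mul_prod_one_sub_pow_le {x : K} (hx : ‖x‖ < 1) (k n : ℕ) :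
    ‖x ^ ((k + 1) * n) * ∏ i ∈ Finset.range (n + 1), (1 - x ^ (k + i + 1))‖
      ≤ ‖x‖ ^ n * Real.exp (1 - ‖x‖)⁻¹ := by
  rw [norm_mul, norm_pow]
  exact mul_le_mul
    (pow_le_pow_of_le_one (norm_nonneg x) hx.le (Nat.le_mul_of_pos_left n k.succ_pos))
    (norm_prod_one_sub_pow_le hx k (n + 1)) (norm_nonneg _) (pow_nonneg (norm_nonneg x) n)

theorem natAbs_le_pentagonal (k : ℤ) : k.natAbs ≤ pentagonal k := by
  have h := two_mul_natCast_pentagonal k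
  zify
  rcases le_total 0 k with hk | hk
  · rw [abs_of_nonneg hk]
    rcases hk.eq_or_lt with rfl | hk
    · simp
    · nlinarith
  · rw [abs_of_nonpos hk]
    nlinarith

theorem summable_negOnePow_mul_pow_pentagonal [CompleteSpace K] {x : K} (hx : ‖x‖ < 1) :
    Summable fun k : ℤ => (-1 : K) ^ k * x ^ pentagonal k := by
  have hg := summable_geometric_of_lt_one (norm_nonneg x) hx
  refine .of_norm_bounded (g := fun k : ℤ => ‖x‖ ^ k.natAbs)
    (.of_nat_of_neg (by simpa using hg) (by simpa using hg)) fun k => ?_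
  rw [norm_mul, norm_zpow, norm_neg, norm_one, one_zpow, one_mul, norm_pow]
  exact pow_le_pow_of_le_one (norm_nonneg x) hx.le (natAbs_le_pentagonal k)

/-- Folds the bilateral sum by pairing the indices `-k` and `k + 1`, as
`Pentagonal.tprod_one_sub_pow` requires. -/
theorem HasSum.pentagonal_nat {x s : K} [CompleteSpace K]
    (h : HasSum (fun k : ℤ => (-1 : K) ^ k * x ^ pentagonal k) s) :
    HasSum (fun k : ℕ => (-1 : K) ^ k * (x ^ pentagonal (-k) - x ^ pentagonal (k + 1))) s := by
  rw [← neg_injective.hasSum_iff (fun y hy => by absurd hy; use -y; simp)] at h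
  convert h.nat_add_neg_add_one using 2 with k
  have h1 : (-1 : K) ^ (-(k : ℤ)) = (-1) ^ k := by
    rw [zpow_neg, zpow_natCast, ← inv_pow, inv_neg, inv_one]
  have h2 : (-1 : K) ^ ((k : ℤ) + 1) = -(-1) ^ k := by
    rw [zpow_add_one₀ (by simp), zpow_natCast]; ring
  simp only [Function.comp_apply, neg_neg, h1, h2]
  ring

/-- **Pentagonal number theorem** in a complete normed field. -/
theorem tsum_pentagonal_eq_tprod [CompleteSpace K] {x : K} (hx : ‖x‖ < 1) :
    ∑' k : ℤ, (-1 : K) ^ k * x ^ pentagonal k = ∏' n : ℕ, (1 - x ^ (n + 1)) := by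
  have hg := (summable_geometric_of_lt_one (norm_nonneg x) hx).mul_right
    (Real.exp (1 - ‖x‖)⁻¹)
  have hnat := (summable_negOnePow_mul_pow_pentagonal hx).hasSum.pentagonal_nat
  rw [Pentagonal.tprod_one_sub_pow (tendsto_pow_atTop_nhds_zero_of_norm_lt_one hx)
    (fun k => .of_norm_bounded hg (norm_pow_mul_prod_one_sub_pow_le hx k)) (fun k => ?mult)
    hnat.summable ?tail, hnat.tsum_eq]
  case mult =>
    convert multipliable_one_sub_mul_pow hx (x ^ (k + 1)) using 3
    ring
  case tail =>
    -- The power of `x` in front has exponent at least `k`, and the series it multiplies is bounded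
    -- uniformly in `k`.
    refine squeeze_zero_norm (a := fun k => ‖x‖ ^ k *
      ∑' n : ℕ, ‖x‖ ^ n * Real.exp (1 - ‖x‖)⁻¹) (fun k => ?_) ?_
    · rw [norm_mul, norm_mul, norm_pow, norm_neg, norm_one, one_pow, one_mul, norm_pow]
      refine mul_le_mul ?_ ?_ (norm_nonneg _) (pow_nonneg (norm_nonneg x) k)
      · refine pow_le_pow_of_le_one (norm_nonneg x) hx.le ?_
        rw [Nat.le_div_iff_mul_le two_pos]
        nlinarith
      · exact tsum_of_norm_bounded hg.hasSum (norm_pow_mul_prod_one_sub_pow_le hx k)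
    · simpa using (tendsto_pow_atTop_nhds_zero_of_lt_one (norm_nonneg x) hx).mul_const
        (∑' n : ℕ, ‖x‖ ^ n * Real.exp (1 - ‖x‖)⁻¹)

theorem sq_pow_pentagonal (q : K) (k : ℤ) : (q ^ 2) ^ pentagonal k = q ^ (3 * k ^ 2 - k) := by
  rw [← pow_mul, ← zpow_natCast]
  push_cast
  rw [two_mul_natCast_pentagonal]
  ring_nf

end Pentagonal

theorem corollary5p6 {K : Type*} [NormedField K] [CompleteSpace K] (q : K) (hq : ‖q‖ < 1) :
    -- the infinite products and the bilateral series converge, and no denominator vanishes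
    (Multipliable fun j : ℕ => 1 - q * q ^ j) ∧
    (Multipliable fun j : ℕ => 1 - q ^ 2 * (q ^ 2) ^ j) ∧
    (Multipliable fun j : ℕ => 1 - (-q) * q ^ j) ∧
    (Summable fun k : ℤ => (-1 : K) ^ k * q ^ (3 * k ^ 2 - k)) ∧
    (∀ n : ℕ, qPoch q q n ≠ 0) ∧
    qPochInf q q ≠ 0 ∧
    -- the two series
    HasSum (fun n : ℕ => q ^ (2 * (n : ℤ) ^ 2 + n) / qPoch q q (2 * n + 1))
      (1 / qPochInf q q * ∑' k : ℤ, (-1 : K) ^ k * q ^ (3 * k ^ 2 - k)) ∧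
    HasSum (fun n : ℕ => q ^ (2 * (n : ℤ) ^ 2 - n) / qPoch q q (2 * n))
      (1 / qPochInf q q * ∑' k : ℤ, (-1 : K) ^ k * q ^ (3 * k ^ 2 - k)) ∧
    -- the product forms of their common value
    1 / qPochInf q q * ∑' k : ℤ, (-1 : K) ^ k * q ^ (3 * k ^ 2 - k)
      = qPochInf (q ^ 2) (q ^ 2) / qPochInf q q ∧
    qPochInf (q ^ 2) (q ^ 2) / qPochInf q q = qPochInf (-q) q := by
  have hq2 : ‖q ^ 2‖ < 1 := by
    rw [norm_pow]
    exact pow_lt_one₀ (norm_nonneg q) hq two_ne_zero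
  have hne := qPochInf_self_ne_zero hq
  have hsum := summable_negOnePow_mul_pow_pentagonal hq2
  have hpent : ∑' k : ℤ, (-1 : K) ^ k * q ^ (3 * k ^ 2 - k) = qPochInf (q ^ 2) (q ^ 2) := by
    have h := tsum_pentagonal_eq_tprod hq2
    simp only [sq_pow_pentagonal] at h
    rw [h, qPochInf]
    exact tprod_congr fun j => by rw [pow_succ' (q ^ 2) j]
  have hprod : qPochInf (q ^ 2) (q ^ 2) / qPochInf q q = qPochInf (-q) q := by
    rw [qPochInf_sq_sq hq, mul_div_cancel_right₀ _ hne]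
  have hval : 1 / qPochInf q q * ∑' k : ℤ, (-1 : K) ^ k * q ^ (3 * k ^ 2 - k)
      = qPochInf (q ^ 2) (q ^ 2) / qPochInf q q := by
    rw [hpent, one_div_mul_eq_div]
  refine ⟨multipliable_one_sub_mul_pow hq q, multipliable_one_sub_mul_pow hq2 _,
    multipliable_one_sub_mul_pow hq _, by simpa only [sq_pow_pentagonal] using hsum,
    qPoch_self_ne_zero hq, hne, ?_, ?_, hval, hprod⟩
  · rw [hval, hprod]
    exact hasSum_pow_div_qPoch_odd hq
  · rw [hval, hprod]
    exact hasSum_pow_div_qPoch_even hq
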